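/- **Theorem (accuracy of semi-implicit iteration schemes).** Let $Q\in\mathbb{R}^{d\times d}$ be symmetric, $V(y)=\tfrac12\langle y,Qy\rangle$ (so $\nabla V(y)=Qy$), and $S:\mathbb{R}^d\to\mathbb{R}^{d\times d}$. Let $\|\cdot\|$ be the Euclidean norm and $\|\cdot\|_2$ the induced matrix norm. Let $A=(a_{ij})\in\mathbb{R}^{s\times s}$, $b\in\mathbb{R}^s$ be the coefficients of an $s$-stage Runge–Kutta method, and $c_i=\sum_{j=1}^s a_{ij}$. The method is said to have order (at least) $p\in\mathbb{N}$ if for every autonomous system $\dot y=f(y)$ in some $\mathbb{R}^n$ with $f$ of class $C^p$, and every exact solution $y$ on an interval $[0,T)$, $T>0$, the result $y_1=y(0)+h\sum_i b_i f(Y_i)$, with stages $Y_i=y(0)+h\sum_j a_{ij}f(Y_j)$ lying in a sufficiently small fixed ball around $y(0)$, satisfies $\|y_1-y(h)\|\le Kh^{p+1}$ for all sufficiently small $h>0$, with $K$ independent of $h$. Let $y$ be a solution of $\dot y=S(y)\nabla V(y)$ on $[\tau,T)$, where $\tau\le 0<T$ and $\tau<0$ if some $c_i<0$ (so $\tau=0$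 is allowed when all $c_i\ge0$), and put $y_0=y(0)$. Given starting values $Y_1^{(0)},\dots,Y_s^{(0)}\in\mathbb{R}^d$, the semi-implicit iteration with step size $h$ is $$Y_i^{(m)}=y_0+h\sum_{j=1}^s a_{ij}\,S\bigl(Y_j^{(m-1)}\bigr)\nabla V\bigl(Y_j^{(m)}\bigr)\quad(i=1,\dots,s;\ m=1,\dots,k),$$ with output after $k\ge1$ iterations $$y_1^{(k)}=y_0+h\sum_{j=1}^s b_j\,S\bigl(Y_j^{(k-1)}\bigr)\nabla V\bigl(Y_j^{(k)}\bigr).$$ Assume that $S$ is Lipschitz continuous, $\|S(u)-S(v)\|_2\le L_S\|u-v\|$ for all $u,v\in\mathbb{R}^d$; that the Runge–Kutta method $(A,b)$ has order $p$; and, if $p\ge2$, that $S$ is moreover of class $C^p$. Then for every $k\ge1$ and $C\in\mathbb{R}$ there are constants $C'$ and $h_0>0$, depending only on $y,k,S,Q,A,b$ (with its order $p$) and $C$, such that for every $q\in\mathbb{N}=\{0,1,2,\dots\}$, every $0<h\le h_0$ and all starting values with $$\bigl\|Y_i^{(0)}-y(c_ih)\bigr\|\le C h^{q}\qquad(i=1,\dots,s),$$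 the $k$ linear systems of the iteration can be solved, and every such iteration satisfies $$\bigl\|y_1^{(k)}-y(h)\bigr\|\le C'\,h^{\min\{p,\;q+k-1\}+1}.$$ -/

import Mathlib

open scoped Gradient Matrix.Norms.L2Operator

noncomputable section

namespace SemiImplicitRK

/-- The space `ℝ^d` with the Euclidean norm. (Square matrices carry the induced operator 2-norm,
through the scoped instances opened above.) -/
abbrev Vec (d : ℕ) : Type := EuclideanSpace ℝ (Fin d)

/-- The quadratic function `V(y) = ½ ⟨y, Q y⟩`. -/
def quadV {d : ℕ} (Q : Matrix (Fin d) (Fin d) ℝ) (y : Vec d) : ℝ :=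
  (1 / 2 : ℝ) * inner ℝ y (Matrix.toEuclideanCLM (n := Fin d) (𝕜 := ℝ) Q y)

/-- For symmetric `Q`, `∇V(y) = Q y`. -/
theorem gradient_quadV {d : ℕ} {Q : Matrix (Fin d) (Fin d) ℝ} (hQ : Q.IsSymm) (y : Vec d) :
    ∇ (quadV Q) y = Matrix.toEuclideanCLM (n := Fin d) (𝕜 := ℝ) Q y := by
  apply HasGradientAt.gradient
  rw [hasGradientAt_iff_hasFDerivAt]
  have hT := (Matrix.toEuclideanCLM (n := Fin d) (𝕜 := ℝ) Q).hasFDerivAt (x := y)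
  refine (((hasFDerivAt_id y).inner ℝ hT).const_mul (1 / 2 : ℝ)).congr_fderiv ?_
  ext v
  have hs : inner ℝ y (Matrix.toEuclideanCLM (n := Fin d) (𝕜 := ℝ) Q v)
      = inner ℝ (Matrix.toEuclideanCLM (n := Fin d) (𝕜 := ℝ) Q y) v := by
    rw [← ContinuousLinearMap.adjoint_inner_left, ← ContinuousLinearMap.star_eq_adjoint,
      ← map_star, Matrix.star_eq_conjTranspose, Matrix.conjTranspose_eq_transpose_of_trivial, hQ.eq]
  simp [hs, real_inner_comm]
  ring

/-- The two-argument vector field `(u, v) ↦ S(u) ∇V(v)`. -/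
def field {d : ℕ} (S : Vec d → Matrix (Fin d) (Fin d) ℝ) (Q : Matrix (Fin d) (Fin d) ℝ)
    (u v : Vec d) : Vec d :=
  Matrix.toEuclideanCLM (n := Fin d) (𝕜 := ℝ) (S u) (∇ (quadV Q) v)

/-- The nodes `c_i = ∑_j a_{ij}` of a Runge--Kutta method. -/
def nodes {s : ℕ} (A : Matrix (Fin s) (Fin s) ℝ) (i : Fin s) : ℝ := ∑ j, A i j

/-- `Y` solves the stage equations `Y_i = y₀ + h ∑_j a_{ij} f(Y_j)`. -/
def IsRKStages {n s : ℕ} (A : Matrix (Fin s) (Fin s) ℝ) (f : Vec n → Vec n) (h : ℝ) (y₀ : Vec n)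
    (Y : Fin s → Vec n) : Prop :=
  ∀ i, Y i = y₀ + h • ∑ j, A i j • f (Y j)

/-- The Runge--Kutta output `y₁ = y₀ + h ∑_i b_i f(Y_i)`. -/
def rkOutput {n s : ℕ} (b : Fin s → ℝ) (f : Vec n → Vec n) (h : ℝ) (y₀ : Vec n)
    (Y : Fin s → Vec n) : Vec n :=
  y₀ + h • ∑ i, b i • f (Y i)

/-- The Runge--Kutta method `(A, b)` has order (at least) `p`: for every autonomous system
`y' = f(y)` in some `ℝ^n` with `f` of class `C^p` and every exact solution `y` on an interval
`[0, T)`, the local error satisfies `y₁ - y(h) = O(h^{p+1})` as `h → 0+`. The stage equations of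
an implicit method may have spurious solutions, which run away to infinity as `h → 0`; the radius
`r` singles out the stages near the initial value. -/
def HasOrder {s : ℕ} (A : Matrix (Fin s) (Fin s) ℝ) (b : Fin s → ℝ) (p : ℕ) : Prop :=
  ∀ (n : ℕ) (f : Vec n → Vec n), ContDiff ℝ p f →
    ∀ (T : ℝ), 0 < T → ∀ y : ℝ → Vec n, IsIntegralCurveOn y (fun _ => f) (Set.Ico 0 T) →
      ∃ K r h₀ : ℝ, 0 < r ∧ 0 < h₀ ∧ ∀ h : ℝ, 0 < h → h ≤ h₀ →
        ∀ Y : Fin s → Vec n, IsRKStages A f h (y 0) Y → (∀ i, ‖Y i - y 0‖ ≤ r) →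
          ‖rkOutput b f h (y 0) Y - y h‖ ≤ K * h ^ (p + 1)

/-- `Y 0, …, Y k` are the stage vectors of `k` semi-implicit iterations with step size `h`:
`Y_i^{(m+1)} = y₀ + h ∑_j a_{ij} S(Y_j^{(m)}) ∇V(Y_j^{(m+1)})` for `m < k`.
(The values of `Y` beyond index `k` play no role.) -/
def IsSemiImplicitIteration {d s : ℕ} (S : Vec d → Matrix (Fin d) (Fin d) ℝ)
    (Q : Matrix (Fin d) (Fin d) ℝ) (A : Matrix (Fin s) (Fin s) ℝ) (h : ℝ) (y₀ : Vec d) (k : ℕ)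
    (Y : ℕ → Fin s → Vec d) : Prop :=
  ∀ m < k, ∀ i, Y (m + 1) i = y₀ + h • ∑ j, A i j • field S Q (Y m j) (Y (m + 1) j)

/-- The output `y₁^{(k)} = y₀ + h ∑_j b_j S(Y_j^{(k-1)}) ∇V(Y_j^{(k)})` after `k ≥ 1` iterations. -/
def semiImplicitOutput {d s : ℕ} (S : Vec d → Matrix (Fin d) (Fin d) ℝ)
    (Q : Matrix (Fin d) (Fin d) ℝ) (b : Fin s → ℝ) (h : ℝ) (y₀ : Vec d) (k : ℕ)
    (Y : ℕ → Fin s → Vec d) : Vec d :=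
  y₀ + h • ∑ j, b j • field S Q (Y (k - 1) j) (Y k j)

end SemiImplicitRK

end

/-!
The field `u ↦ S(u) ∇V(u)` is written `u ↦ G u u` with the operator-valued, Lipschitz coefficient
`G u = S(u) Q`. Each sweep of the iteration then is a system of stage equations that is linear in
the new stages, and for small `h` it is a perturbation of the identity of norm at most `1/2`. This
gives solvability, bounds for all stages that depend only on a bound for the starting values, and
stability: a perturbation of the old stages by `δ` changes the new ones by `O(h δ)`. After `k`
sweeps, starting values differing by `O(h^q)` lead to outputs differing by `O(h^(q+k))`
(`norm_iterationOutput_sub_le`), with constants that do not involve `q`.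

So it suffices to treat the exact starting values `y(c_i h)` and to show that the output then has
error `O(h^(p+1))`. With these starting values, the iteration is literally the Runge--Kutta method
applied to the cascade

  `t' = 1`, `z₁' = G(y(t)) z₁`, `z₂' = G(z₁) z₂`, …, `z_k' = G(z_{k-1}) z_k`,

since the stages of the component `t` are `c_i h`; and `z₁ = ⋯ = z_k = y` solves the cascade. The
order condition, used for this one system, gives the estimate
(`exists_exact_start_error_le_of_two_le`). The order condition asks for a globally defined vector
field of class `C^p`, so `y` is continued backwards past `0` if necessary
(`exists_two_sided_extension`), is of class `C^p` by bootstrapping, and is cut off away from `0`.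

For `p ≤ 1` the coefficient `G` need not be differentiable and the order condition does not apply
to the cascade. There it is only used for `y' = 1`, where it controls `∑ b_i - 1`; the estimate
follows from first-order expansions of the solution and of the stages
(`exists_exact_start_error_le_of_le_one`).
-/

noncomputable section

open Filter Topology Set

namespace SemiImplicitRK

/-! ### Linear stage equations -/

section LinearStages

variable {ι E : Type*} [Fintype ι] [NormedAddCommGroup E] [NormedSpace ℝ E]

theorem norm_sum_smul_le_sum_abs_mul (c : ι → ℝ) {x : ι → E} {M : ℝ} (hx : ∀ j, ‖x j‖ ≤ M) :
    ‖∑ j, c j • x j‖ ≤ (∑ j, |c j|) * M := by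
  rw [Finset.sum_mul]
  refine norm_sum_le_of_le _ fun j _ => ?_
  rw [norm_smul, Real.norm_eq_abs]
  exact mul_le_mul_of_nonneg_left (hx j) (abs_nonneg _)

theorem norm_smul_sum_smul_le {c : ι → ℝ} {x : ι → E} {M a h : ℝ} (hh : 0 ≤ h) (hM : 0 ≤ M)
    (hc : ∑ j, |c j| ≤ a) (hx : ∀ j, ‖x j‖ ≤ M) : ‖h • ∑ j, c j • x j‖ ≤ h * (a * M) := by
  rw [norm_smul, Real.norm_of_nonneg hh]
  exact mul_le_mul_of_nonneg_left ((norm_sum_smul_le_sum_abs_mul c hx).trans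
    (mul_le_mul_of_nonneg_right hc hM)) hh

/-- For small step size the linear stage map is a perturbation of the identity by an operator of
norm at most `1/2` (in the sup norm over the stages), whence the factor `2`. -/
theorem norm_le_of_linear_stages {A : Matrix ι ι ℝ} {P : ι → E →L[ℝ] E} {w D : ι → E}
    {a B W h : ℝ} (hh : 0 ≤ h) (hB : 0 ≤ B) (hW : 0 ≤ W) (hA : ∀ i, ∑ j, |A i j| ≤ a)
    (hP : ∀ j, ‖P j‖ ≤ B) (hs : h * (a * B) ≤ 1 / 2) (hw : ∀ i, ‖w i‖ ≤ W)
    (hD : ∀ i, D i = w i + h • ∑ j, A i j • P j (D j)) (i : ι) : ‖D i‖ ≤ 2 * W := by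
  have hn : 0 ≤ ‖D‖ := norm_nonneg D
  have key : ‖D‖ ≤ W + 1 / 2 * ‖D‖ := by
    refine (pi_norm_le_iff_of_nonneg (by positivity)).2 fun i => ?_
    rw [hD i]
    refine (norm_add_le _ _).trans (add_le_add (hw i) ?_)
    refine (norm_smul_sum_smul_le hh (mul_nonneg hB hn) (hA i) fun j =>
      ((P j).le_opNorm _).trans (mul_le_mul (hP j) (norm_le_pi_norm D j) (norm_nonneg _) hB)).trans
      ?_
    calc h * (a * (B * ‖D‖)) = h * (a * B) * ‖D‖ := by ring
      _ ≤ _ := mul_le_mul_of_nonneg_right hs hn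
  linarith [norm_le_pi_norm D i]

/-- In finite dimension, the a priori bound for the homogeneous equation yields solvability. -/
theorem exists_linear_stages [FiniteDimensional ℝ E] {A : Matrix ι ι ℝ} {P : ι → E →L[ℝ] E}
    {a B h : ℝ} (hh : 0 ≤ h) (hB : 0 ≤ B) (hA : ∀ i, ∑ j, |A i j| ≤ a)
    (hP : ∀ j, ‖P j‖ ≤ B) (hs : h * (a * B) ≤ 1 / 2) (w : ι → E) :
    ∃ D : ι → E, ∀ i, D i = w i + h • ∑ j, A i j • P j (D j) := by
  let T : (ι → E) →ₗ[ℝ] (ι → E) :=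
    { toFun := fun D i => D i - h • ∑ j, A i j • P j (D j)
      map_add' := fun D D' => by
        ext i
        simp only [Pi.add_apply, map_add, smul_add, Finset.sum_add_distrib]
        abel
      map_smul' := fun r D => by
        ext i
        simp only [Pi.smul_apply, map_smul, RingHom.id_apply, smul_sub, Finset.smul_sum]
        congr 1
        refine Finset.sum_congr rfl fun j _ => ?_
        simp only [smul_smul]
        congr 1
        ring }
  have hinj : Function.Injective T := by
    rw [injective_iff_map_eq_zero]
    intro D hD
    have h0 : ∀ i, D i = (0 : ι → E) i + h • ∑ j, A i j • P j (D j) := fun i => by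
      have : D i - h • ∑ j, A i j • P j (D j) = 0 := congrFun hD i
      rw [Pi.zero_apply, zero_add]
      exact sub_eq_zero.1 this
    ext i
    have := norm_le_of_linear_stages hh hB le_rfl hA hP hs (by simp) h0 i
    simpa using this
  obtain ⟨D, hD⟩ := LinearMap.injective_iff_surjective.1 hinj w
  exact ⟨D, fun i => sub_eq_iff_eq_add.1 (congrFun hD i)⟩

end LinearStages

/-! ### Bounds and stability of the iteration -/

section Iteration

variable {ι E : Type*} [Fintype ι] [NormedAddCommGroup E] [NormedSpace ℝ E]

/-- The semi-implicit iteration for the vector field `u ↦ G u u` with an operator-valued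
coefficient `G`: each sweep is linear in the new stages, with `G` frozen at the old ones. Only the
values `Y 0, …, Y k` matter. -/
def IsIteration (A : Matrix ι ι ℝ) (G : E → E →L[ℝ] E) (h : ℝ) (y₀ : E) (k : ℕ)
    (Y : ℕ → ι → E) : Prop :=
  ∀ m < k, ∀ i, Y (m + 1) i = y₀ + h • ∑ j, A i j • G (Y m j) (Y (m + 1) j)

/-- The output of the iteration after `k` sweeps. -/
def iterationOutput (b : ι → ℝ) (G : E → E →L[ℝ] E) (h : ℝ) (y₀ : E) (k : ℕ)
    (Y : ℕ → ι → E) : E :=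
  y₀ + h • ∑ j, b j • G (Y (k - 1) j) (Y k j)

variable {A : Matrix ι ι ℝ} {G : E → E →L[ℝ] E} {L : NNReal} {y₀ : E} {a h R : ℝ} {k : ℕ}

theorem norm_coeff_le (hG : LipschitzWith L G) {u : E} (hu : ‖u‖ ≤ R) : ‖G u‖ ≤ ‖G 0‖ + L * R := by
  have h1 := hG.norm_sub_le u 0
  rw [sub_zero] at h1
  have h2 := norm_le_norm_add_norm_sub' (G u) (G 0)
  have h3 : (L : ℝ) * ‖u‖ ≤ L * R := mul_le_mul_of_nonneg_left hu L.2
  linarith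

theorem norm_coeff_apply_sub_le (hG : LipschitzWith L G) (u v u' v' : E) :
    ‖G u v - G u' v'‖ ≤ ‖G u‖ * ‖v - v'‖ + L * ‖u - u'‖ * ‖v'‖ := by
  have : G u v - G u' v' = G u (v - v') + (G u - G u') v' := by simp
  rw [this]
  refine (norm_add_le _ _).trans (add_le_add ((G u).le_opNorm _) ?_)
  exact ((G u - G u').le_opNorm _).trans
    (mul_le_mul_of_nonneg_right (hG.norm_sub_le u u') (norm_nonneg _))

theorem norm_iteration_le (hG : LipschitzWith L G) (hA : ∀ i, ∑ j, |A i j| ≤ a) (hh : 0 ≤ h)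
    (hR : 2 * ‖y₀‖ ≤ R) (hs : h * (a * (‖G 0‖ + L * R)) ≤ 1 / 2) {Y : ℕ → ι → E}
    (hY : IsIteration A G h y₀ k Y) (h0 : ∀ i, ‖Y 0 i‖ ≤ R) :
    ∀ m ≤ k, ∀ i, ‖Y m i‖ ≤ R := by
  have hR0 : 0 ≤ R := le_trans (by positivity) hR
  intro m
  induction m with
  | zero => exact fun _ => h0
  | succ m ih =>
    intro hm i
    exact (norm_le_of_linear_stages hh (by positivity) (norm_nonneg y₀) hA
      (fun j => norm_coeff_le hG (ih (by omega) j)) hs (fun _ => le_rfl) (hY m hm) i).trans hR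

/-- Each sweep contracts perturbations of the stages by a factor `O(h)`. -/
theorem norm_iteration_sub_le (hG : LipschitzWith L G) (hA : ∀ i, ∑ j, |A i j| ≤ a) (ha : 0 ≤ a)
    (hh : 0 ≤ h) (hR : 2 * ‖y₀‖ ≤ R) (hs : h * (a * (‖G 0‖ + L * R)) ≤ 1 / 2) {δ : ℝ} (hδ : 0 ≤ δ)
    {Y Z : ℕ → ι → E} (hY : IsIteration A G h y₀ k Y) (hZ : IsIteration A G h y₀ k Z)
    (hY0 : ∀ i, ‖Y 0 i‖ ≤ R) (hZ0 : ∀ i, ‖Z 0 i‖ ≤ R) (h0 : ∀ i, ‖Y 0 i - Z 0 i‖ ≤ δ) :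
    ∀ m ≤ k, ∀ i, ‖Y m i - Z m i‖ ≤ (2 * (a * (L * R))) ^ m * h ^ m * δ := by
  have hR0 : 0 ≤ R := le_trans (by positivity) hR
  have hYb := norm_iteration_le hG hA hh hR hs hY hY0
  have hZb := norm_iteration_le hG hA hh hR hs hZ hZ0
  intro m
  induction m with
  | zero => simpa using h0
  | succ m ih =>
    intro hm i
    set ε : ℝ := (2 * (a * (L * R))) ^ m * h ^ m * δ with hε
    have hε0 : 0 ≤ ε := by positivity
    -- The difference of the new stages solves linear stage equations with the coefficients of `Y`
    -- and an inhomogeneity coming from the change of coefficients.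
    have hD : ∀ i, Y (m + 1) i - Z (m + 1) i =
        h • ∑ j, A i j • (G (Y m j) - G (Z m j)) (Z (m + 1) j) +
          h • ∑ j, A i j • G (Y m j) (Y (m + 1) j - Z (m + 1) j) := fun i => by
      rw [hY m hm i, hZ m hm i, add_sub_add_left_eq_sub, ← smul_sub, ← smul_add,
        ← Finset.sum_sub_distrib, ← Finset.sum_add_distrib]
      congr 1
      refine Finset.sum_congr rfl fun j _ => ?_
      rw [← smul_sub, ← smul_add]
      congr 1
      simp
    have hw : ∀ i, ‖h • ∑ j, A i j • (G (Y m j) - G (Z m j)) (Z (m + 1) j)‖ ≤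
        h * (a * (L * ε * R)) := fun i =>
      norm_smul_sum_smul_le hh (by positivity) (hA i) fun j =>
        ((G (Y m j) - G (Z m j)).le_opNorm _).trans
          (mul_le_mul ((hG.norm_sub_le _ _).trans
            (mul_le_mul_of_nonneg_left (ih (by omega) j) L.2)) (hZb _ hm j) (norm_nonneg _)
            (by positivity))
    refine (norm_le_of_linear_stages (D := fun i => Y (m + 1) i - Z (m + 1) i) hh (by positivity)
      (by positivity) hA (fun j => norm_coeff_le hG (hYb m (by omega) j)) hs hw hD i).trans_eq ?_
    rw [hε]
    ring

/-- Stability of the output. The explicit factor `h ^ k * δ` does not depend on how `δ` scales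
with `h`, so one constant serves all accuracies `δ = C h ^ q` of the starting values. -/
theorem norm_iterationOutput_sub_le (b : ι → ℝ) (hG : LipschitzWith L G)
    (hA : ∀ i, ∑ j, |A i j| ≤ a) (ha : 0 ≤ a) (hh : 0 ≤ h) (hh1 : h ≤ 1) (hR : 2 * ‖y₀‖ ≤ R)
    (hs : h * (a * (‖G 0‖ + L * R)) ≤ 1 / 2) {δ : ℝ} (hδ : 0 ≤ δ)
    {Y Z : ℕ → ι → E} (hk : 1 ≤ k) (hY : IsIteration A G h y₀ k Y) (hZ : IsIteration A G h y₀ k Z)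
    (hY0 : ∀ i, ‖Y 0 i‖ ≤ R) (hZ0 : ∀ i, ‖Z 0 i‖ ≤ R) (h0 : ∀ i, ‖Y 0 i - Z 0 i‖ ≤ δ) :
    ‖iterationOutput b G h y₀ k Y - iterationOutput b G h y₀ k Z‖ ≤
      (∑ j, |b j|) * ((‖G 0‖ + L * R) * (2 * (a * (L * R))) ^ k +
        L * R * (2 * (a * (L * R))) ^ (k - 1)) * h ^ k * δ := by
  have hR0 : 0 ≤ R := le_trans (by positivity) hR
  obtain ⟨n, rfl⟩ : ∃ n, k = n + 1 := ⟨k - 1, by omega⟩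
  have hYb := norm_iteration_le hG hA hh hR hs hY hY0
  have hZb := norm_iteration_le hG hA hh hR hs hZ hZ0
  have hd := norm_iteration_sub_le hG hA ha hh hR hs hδ hY hZ hY0 hZ0 h0
  set D : ℝ := 2 * (a * (L * R)) with hD
  set B : ℝ := ‖G 0‖ + L * R with hB
  have hD0 : 0 ≤ D := by positivity
  have hB0 : 0 ≤ B := by positivity
  have hterm : ∀ j, ‖G (Y n j) (Y (n + 1) j) - G (Z n j) (Z (n + 1) j)‖ ≤
      (B * D ^ (n + 1) + L * R * D ^ n) * h ^ n * δ := fun j => by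
    refine (norm_coeff_apply_sub_le hG _ _ _ _).trans ?_
    have h1 : ‖G (Y n j)‖ * ‖Y (n + 1) j - Z (n + 1) j‖ ≤ B * (D ^ (n + 1) * h ^ n * δ) := by
      refine mul_le_mul (norm_coeff_le hG (hYb n (by omega) j)) ((hd _ le_rfl j).trans ?_)
        (norm_nonneg _) hB0
      have : h ^ (n + 1) ≤ h ^ n := pow_le_pow_of_le_one hh hh1 (by omega)
      gcongr
    have h2 : L * ‖Y n j - Z n j‖ * ‖Z (n + 1) j‖ ≤ L * (D ^ n * h ^ n * δ) * R :=
      mul_le_mul (mul_le_mul_of_nonneg_left (hd _ (by omega) j) L.2) (hZb _ le_rfl j)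
        (norm_nonneg _) (by positivity)
    refine (add_le_add h1 h2).trans_eq ?_
    ring
  have heq : iterationOutput b G h y₀ (n + 1) Y - iterationOutput b G h y₀ (n + 1) Z =
      h • ∑ j, b j • (G (Y n j) (Y (n + 1) j) - G (Z n j) (Z (n + 1) j)) := by
    simp only [iterationOutput, add_tsub_cancel_right, add_sub_add_left_eq_sub, smul_sub,
      Finset.sum_sub_distrib]
  rw [heq]
  refine (norm_smul_sum_smul_le hh (by positivity) le_rfl hterm).trans_eq ?_
  simp only [add_tsub_cancel_right]
  ring

theorem exists_isIteration [FiniteDimensional ℝ E] (hG : LipschitzWith L G)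
    (hA : ∀ i, ∑ j, |A i j| ≤ a) (hh : 0 ≤ h) (hR : 2 * ‖y₀‖ ≤ R)
    (hs : h * (a * (‖G 0‖ + L * R)) ≤ 1 / 2) (Y₀ : ι → E) (h0 : ∀ i, ‖Y₀ i‖ ≤ R) (k : ℕ) :
    ∃ Y : ℕ → ι → E, Y 0 = Y₀ ∧ IsIteration A G h y₀ k Y := by
  have hR0 : 0 ≤ R := le_trans (by positivity) hR
  induction k with
  | zero => exact ⟨fun _ => Y₀, rfl, fun m hm => absurd hm (by omega)⟩
  | succ k ih =>
    obtain ⟨Y, hY0, hY⟩ := ih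
    have hb := norm_iteration_le hG hA hh hR hs hY (by simpa [hY0] using h0) k le_rfl
    obtain ⟨D, hD⟩ := exists_linear_stages hh (by positivity) hA
      (fun j => norm_coeff_le hG (hb j)) hs (fun _ => y₀)
    refine ⟨Function.update Y (k + 1) D, by simp [hY0], fun m hm i => ?_⟩
    rw [Function.update_of_ne (show m ≠ k + 1 by omega)]
    rcases Nat.lt_succ_iff_lt_or_eq.1 hm with hm | rfl
    · rw [Function.update_of_ne (show m + 1 ≠ k + 1 by omega)]
      exact hY m hm i
    · simpa using hD i

end Iteration

/-! ### The exact solution near the initial time -/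

theorem eventually_mul_le (c : ℝ) {r : ℝ} (hr : 0 < r) : ∀ᶠ h in 𝓝[>] (0 : ℝ), h * c ≤ r := by
  have : Tendsto (fun h : ℝ => h * c) (𝓝[>] 0) (𝓝 0) :=
    ((continuous_mul_const c).tendsto' 0 0 (zero_mul c)).mono_left nhdsWithin_le_nhds
  exact this.eventually (ge_mem_nhds hr)

section Solution

variable {s : ℕ} {E : Type*} [NormedAddCommGroup E] [NormedSpace ℝ E]
  {A : Matrix (Fin s) (Fin s) ℝ} {τ T : ℝ} {y : ℝ → E}

theorem tendsto_nodes_mul (hτ : τ ≤ 0) (hT : 0 < T) (hc : ∀ i, nodes A i < 0 → τ < 0) (i : Fin s) :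
    Tendsto (fun h => nodes A i * h) (𝓝[>] 0) (𝓝[Ico τ T] 0) := by
  have h0 : Tendsto (fun h => nodes A i * h) (𝓝[>] 0) (𝓝 0) :=
    ((continuous_const_mul (nodes A i)).tendsto' 0 0 (mul_zero _)).mono_left nhdsWithin_le_nhds
  refine tendsto_nhdsWithin_iff.2 ⟨h0, ?_⟩
  have h2 := h0.eventually (gt_mem_nhds hT)
  rcases lt_or_ge (nodes A i) 0 with hi | hi
  · filter_upwards [h0.eventually (lt_mem_nhds (hc i hi)), h2] with h h1 h2
    exact ⟨h1.le, h2⟩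
  · filter_upwards [self_mem_nhdsWithin, h2] with h h1 h2
    exact ⟨hτ.trans (mul_nonneg hi (le_of_lt h1)), h2⟩

theorem exists_norm_solution_nodes_sub_le {v : ℝ → E → E} (hτ : τ ≤ 0) (hT : 0 < T)
    (hc : ∀ i, nodes A i < 0 → τ < 0) (hy : IsIntegralCurveOn y v (Ico τ T)) :
    ∃ M : ℝ, 0 ≤ M ∧ ∀ᶠ h in 𝓝[>] (0 : ℝ), ∀ i, ‖y (nodes A i * h) - y 0‖ ≤ M * h := by
  have h0 : (0 : ℝ) ∈ Ico τ T := ⟨hτ, hT⟩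
  have hO : ∀ i, (fun h => y (nodes A i * h) - y 0) =O[𝓝[>] (0 : ℝ)] (fun h => h) := fun i => by
    have h1 := (hy 0 h0).hasFDerivWithinAt.isBigO_sub.comp_tendsto (tendsto_nodes_mul hτ hT hc i)
    refine h1.trans ?_
    simp only [Function.comp_def, sub_zero]
    exact Asymptotics.isBigO_const_mul_self _ _ _
  obtain ⟨M, hM, hb⟩ := (Asymptotics.isBigO_pi.2 hO).exists_nonneg
  refine ⟨M, hM, ?_⟩
  filter_upwards [hb.bound, self_mem_nhdsWithin] with h h1 h2 i
  rw [Real.norm_of_nonneg (le_of_lt h2)] at h1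
  exact (norm_le_pi_norm (fun i => y (nodes A i * h) - y 0) i).trans h1

/-- First-order Taylor expansion of a solution, with a remainder `O(h ^ 2)`; Lipschitz continuity of
the coefficient suffices, since it makes the derivative of the solution Lipschitz at `0`. -/
theorem exists_norm_solution_sub_taylor_le {G : E → E →L[ℝ] E} {L : NNReal}
    (hG : LipschitzWith L G) (hτ : τ ≤ 0) (hT : 0 < T)
    (hy : IsIntegralCurveOn y (fun _ u => G u u) (Ico τ T)) :
    ∃ N : ℝ, 0 ≤ N ∧
      ∀ᶠ h in 𝓝[>] (0 : ℝ), ‖y h - y 0 - h • G (y 0) (y 0)‖ ≤ N * h ^ 2 := by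
  have h0 : (0 : ℝ) ∈ Ico τ T := ⟨hτ, hT⟩
  have hlim : (𝓝[>] (0 : ℝ)) ≤ 𝓝[Ico τ T] 0 := by
    refine nhdsWithin_le_iff.2 (mem_of_superset (Ioo_mem_nhdsGT hT) fun t ht => ?_)
    exact ⟨hτ.trans ht.1.le, ht.2⟩
  obtain ⟨M, hM, hb⟩ := ((hy 0 h0).hasFDerivWithinAt.isBigO_sub.mono hlim).exists_nonneg
  obtain ⟨δ, hδ, hδb⟩ := mem_nhdsGT_iff_exists_Ioc_subset.1
    (hb.bound.and (Ioo_mem_nhdsGT hT))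
  have hδ0 : (0 : ℝ) < δ := hδ
  have hyt : ∀ t ∈ Icc 0 δ, ‖y t - y 0‖ ≤ M * t := fun t ht => by
    rcases ht.1.eq_or_lt with rfl | ht0
    · simp
    · have := (hδb ⟨ht0, ht.2⟩).1
      rwa [sub_zero, Real.norm_of_nonneg ht.1] at this
  refine ⟨(‖G 0‖ + L * (‖y 0‖ + M * δ)) * M + L * M * ‖y 0‖, by positivity, ?_⟩
  filter_upwards [Ioc_mem_nhdsGT hδ0] with h hh
  set K : ℝ := (‖G 0‖ + L * (‖y 0‖ + M * δ)) * M + L * M * ‖y 0‖ with hK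
  have hK0 : 0 ≤ K := by positivity
  have hsub : Icc 0 h ⊆ Ico τ T := fun t ht =>
    ⟨hτ.trans ht.1, ht.2.trans_lt (hδb hh).2.2⟩
  have hder : ∀ t ∈ Icc 0 h, HasDerivWithinAt (fun t => y t - t • G (y 0) (y 0))
      (G (y t) (y t) - (1 : ℝ) • G (y 0) (y 0)) (Icc 0 h) t := fun t ht =>
    ((hy t (hsub ht)).mono hsub).sub ((hasDerivWithinAt_id t _).smul_const _)
  have hbound : ∀ t ∈ Ico 0 h, ‖G (y t) (y t) - (1 : ℝ) • G (y 0) (y 0)‖ ≤ K * h := fun t ht => by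
    have htδ : t ∈ Icc 0 δ := ⟨ht.1, ht.2.le.trans hh.2⟩
    have h1 : ‖y t - y 0‖ ≤ M * h := (hyt t htδ).trans (mul_le_mul_of_nonneg_left ht.2.le hM)
    have h2 : ‖y t‖ ≤ ‖y 0‖ + M * δ := by
      have := norm_le_norm_add_norm_sub' (y t) (y 0)
      have := hyt t htδ
      have := mul_le_mul_of_nonneg_left htδ.2 hM
      linarith
    rw [one_smul]
    refine (norm_coeff_apply_sub_le hG _ _ _ _).trans ?_
    have h3 : ‖G (y t)‖ * ‖y t - y 0‖ ≤ (‖G 0‖ + L * (‖y 0‖ + M * δ)) * (M * h) :=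
      mul_le_mul (norm_coeff_le hG h2) h1 (norm_nonneg _) (by positivity)
    have h4 : L * ‖y t - y 0‖ * ‖y 0‖ ≤ L * (M * h) * ‖y 0‖ :=
      mul_le_mul_of_nonneg_right (mul_le_mul_of_nonneg_left h1 L.2) (norm_nonneg _)
    refine (add_le_add h3 h4).trans_eq ?_
    rw [hK]
    ring
  have := norm_image_sub_le_of_norm_deriv_le_segment' hder hbound h (right_mem_Icc.2 hh.1.le)
  simp only [zero_smul, sub_zero] at this
  rw [sub_right_comm]
  refine this.trans_eq ?_
  ring

/-- A solution on `[τ, T)` with `τ ≤ 0 < T` extends to a solution on a two-sided neighbourhood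
of `0`: if `τ = 0`, a backward solution is glued on. -/
theorem exists_two_sided_extension [CompleteSpace E] {F : E → E} (hF : ContDiff ℝ 1 F)
    (hτ : τ ≤ 0) (hT : 0 < T) (hy : IsIntegralCurveOn y (fun _ => F) (Ico τ T)) :
    ∃ (ε : ℝ) (z : ℝ → E), 0 < ε ∧ (∀ t ∈ Ioo (-ε) ε, HasDerivAt z (F (z t)) t) ∧
      ∀ t ∈ Ico τ T, z t = y t := by
  rcases hτ.lt_or_eq with hτ | rfl
  · refine ⟨min (-τ) T, y, lt_min (by linarith) hT, fun t ht => ?_, fun _ _ => rfl⟩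
    have h1 : τ < t := by linarith [ht.1, min_le_left (-τ) T]
    have h2 : t < T := by linarith [ht.2, min_le_right (-τ) T]
    exact (hy t ⟨h1.le, h2⟩).hasDerivAt (Ico_mem_nhds h1 h2)
  · obtain ⟨α, hα0, ε, hε, hα⟩ :=
      hF.contDiffAt.exists_forall_mem_closedBall_exists_eq_forall_mem_Ioo_hasDerivAt₀
        (x₀ := y 0) 0
    rw [zero_sub, zero_add] at hα
    have hz : ∀ t, 0 ≤ t → (if t < 0 then α t else y t) = y t := fun t ht =>
      if_neg (not_lt.2 ht)
    have hz' : ∀ t, t ≤ 0 → (if t < 0 then α t else y t) = α t := fun t ht => by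
      rcases ht.lt_or_eq with ht | rfl
      · exact if_pos ht
      · simp [hα0]
    refine ⟨min ε T, fun t => if t < 0 then α t else y t, lt_min hε hT, fun t ht => ?_,
      fun t ht => hz t ht.1⟩
    have h1 : -ε < t := by linarith [ht.1, min_le_left ε T]
    have h1' : t < ε := by linarith [ht.2, min_le_left ε T]
    have h2 : t < T := by linarith [ht.2, min_le_right ε T]
    rcases lt_trichotomy t 0 with h | h | h
    · have he : (fun t => if t < 0 then α t else y t) =ᶠ[𝓝 t] α := by
        filter_upwards [gt_mem_nhds h] with u hu using if_pos hu
      simpa only [if_pos h] using (hα t ⟨h1, h1'⟩).congr_of_eventuallyEq he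
    · subst h
      have hl : HasDerivWithinAt (fun t => if t < 0 then α t else y t) (F (y 0)) (Iic 0) 0 := by
        have := (hα 0 ⟨h1, h1'⟩).hasDerivWithinAt (s := Iic 0)
        rw [hα0] at this
        exact this.congr (fun u hu => hz' u hu) (hz' 0 le_rfl)
      have hr : HasDerivWithinAt (fun t => if t < 0 then α t else y t) (F (y 0)) (Ico 0 T) 0 :=
        (hy 0 ⟨le_rfl, hT⟩).congr (fun u hu => hz u hu.1) (hz 0 le_rfl)
      have hu := (hl.union hr).hasDerivAt (mem_of_superset (Iio_mem_nhds hT) fun u hu =>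
        (le_or_gt u 0).imp id fun h => ⟨h.le, hu⟩)
      simpa only [lt_irrefl, if_false] using hu
    · have he : (fun t => if t < 0 then α t else y t) =ᶠ[𝓝 t] y := by
        filter_upwards [lt_mem_nhds h] with u hu using hz u hu.le
      simpa only [if_neg (not_lt.2 h.le)] using
        ((hy t ⟨h.le, h2⟩).hasDerivAt (Ico_mem_nhds h h2)).congr_of_eventuallyEq he

/-- Bootstrapping: a solution of an autonomous equation is as smooth as the right-hand side. -/
theorem contDiffOn_of_hasDerivAt {F : E → E} {p : ℕ} (hF : ContDiff ℝ p F) {U : Set ℝ}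
    (hU : IsOpen U) {z : ℝ → E} (hz : ∀ t ∈ U, HasDerivAt z (F (z t)) t) :
    ContDiffOn ℝ p z U := by
  have hdiff : DifferentiableOn ℝ z U := fun t ht =>
    (hz t ht).differentiableAt.differentiableWithinAt
  have : ∀ n : ℕ, n ≤ p → ContDiffOn ℝ n z U := by
    intro n
    induction n with
    | zero => exact fun _ => by simpa using hdiff.continuousOn
    | succ n ih =>
      intro hn
      push_cast
      refine (contDiffOn_succ_iff_deriv_of_isOpen hU).2 ⟨hdiff, by simp, ?_⟩
      have hFn : ContDiff ℝ n F := hF.of_le (by exact_mod_cast (by omega : n ≤ p))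
      exact (hFn.comp_contDiffOn (ih (by omega))).congr fun t ht => (hz t ht).deriv
  exact this p le_rfl

/-- A function that is smooth near `0` agrees near `0` with a globally smooth one. -/
theorem exists_contDiff_eq_near_zero {p : ℕ} {ε : ℝ} (hε : 0 < ε) {z : ℝ → E}
    (hz : ContDiffOn ℝ p z (Ioo (-ε) ε)) :
    ∃ (δ : ℝ) (ψ : ℝ → E), 0 < δ ∧ ContDiff ℝ p ψ ∧ ∀ t, |t| ≤ δ → ψ t = z t := by
  let φ : ContDiffBump (0 : ℝ) := ⟨ε / 3, ε / 2, by positivity, by linarith⟩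
  refine ⟨ε / 3, fun t => φ t • z t, by positivity, ?_, fun t ht => ?_⟩
  · refine contDiff_iff_contDiffAt.2 fun t => ?_
    by_cases ht : t ∈ Ioo (-ε) ε
    · exact φ.contDiffAt.smul (hz.contDiffAt (isOpen_Ioo.mem_nhds ht))
    · have hts : t ∉ tsupport φ := fun h => ht <| by
        have h' : |t| ≤ ε / 2 := by
          simpa [φ.tsupport_eq, φ] using h
        have := abs_le.1 h'
        exact ⟨by linarith, by linarith⟩
      have he : (fun t => φ t • z t) =ᶠ[𝓝 t] fun _ => 0 := by
        filter_upwards [(isClosed_tsupport φ).isOpen_compl.mem_nhds hts] with u hu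
        rw [image_eq_zero_of_notMem_tsupport hu, zero_smul]
      exact contDiffAt_const.congr_of_eventuallyEq he
  · have : φ t = 1 := φ.one_of_mem_closedBall (by simpa [φ] using ht)
    simp [this]

end Solution

/-! ### Consequences of the order condition -/

section Order

variable {s : ℕ} {A : Matrix (Fin s) (Fin s) ℝ} {b : Fin s → ℝ} {p : ℕ}

/-- The order condition, stated for coordinate spaces, transfers to every finite-dimensional
normed space. -/
theorem HasOrder.exists_eventually_norm_sub_le (hO : HasOrder A b p) {W : Type*}
    [NormedAddCommGroup W] [NormedSpace ℝ W] [FiniteDimensional ℝ W] {f : W → W}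
    (hf : ContDiff ℝ p f) {T : ℝ} (hT : 0 < T) {y : ℝ → W}
    (hy : IsIntegralCurveOn y (fun _ => f) (Ico 0 T)) :
    ∃ K r : ℝ, 0 ≤ K ∧ 0 < r ∧ ∀ᶠ h in 𝓝[>] (0 : ℝ), ∀ Y : Fin s → W,
      (∀ i, Y i = y 0 + h • ∑ j, A i j • f (Y j)) → (∀ i, ‖Y i - y 0‖ ≤ r) →
        ‖y 0 + h • ∑ i, b i • f (Y i) - y h‖ ≤ K * h ^ (p + 1) := by
  let e : W ≃L[ℝ] Vec (Module.finrank ℝ W) := toEuclidean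
  obtain ⟨K, r, h₀, hr, hh₀, H⟩ := hO _ (fun x => e (f (e.symm x)))
    (e.contDiff.comp (hf.comp e.symm.contDiff)) T hT (fun t => e (y t)) (fun t ht => by
      have h1 : HasDerivWithinAt y (f (y t)) (Ico 0 T) t := hy t ht
      simpa [Function.comp_def] using
        (e : W →L[ℝ] Vec (Module.finrank ℝ W)).hasFDerivAt.comp_hasDerivWithinAt t h1)
  set N := ‖(e : W →L[ℝ] Vec (Module.finrank ℝ W))‖
  set N' := ‖(e.symm : Vec (Module.finrank ℝ W) →L[ℝ] W)‖
  refine ⟨N' * |K|, r / (N + 1), by positivity, by positivity, ?_⟩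
  filter_upwards [Ioc_mem_nhdsGT hh₀] with h hh Y hY hYr
  have hstage : IsRKStages A (fun x => e (f (e.symm x))) h (e (y 0)) fun i => e (Y i) := fun i => by
    simp only [ContinuousLinearEquiv.symm_apply_apply]
    rw [hY i]
    simp
  have hnear : ∀ i, ‖e (Y i) - e (y 0)‖ ≤ r := fun i => by
    rw [← map_sub]
    have h1 : ‖e (Y i - y 0)‖ ≤ N * ‖Y i - y 0‖ :=
      (e : W →L[ℝ] Vec (Module.finrank ℝ W)).le_opNorm _
    have h2 : N * ‖Y i - y 0‖ ≤ (N + 1) * (r / (N + 1)) :=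
      mul_le_mul (by linarith) (hYr i) (norm_nonneg _) (by positivity)
    rw [mul_div_cancel₀ _ (by positivity)] at h2
    exact h1.trans h2
  have hres := H h hh.1 hh.2 _ hstage hnear
  have hout : rkOutput b (fun x => e (f (e.symm x))) h (e (y 0)) (fun i => e (Y i)) - e (y h) =
      e (y 0 + h • ∑ i, b i • f (Y i) - y h) := by
    simp [rkOutput]
  rw [hout] at hres
  have h3 : ‖e.symm (e (y 0 + h • ∑ i, b i • f (Y i) - y h))‖ ≤
      N' * ‖e (y 0 + h • ∑ i, b i • f (Y i) - y h)‖ :=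
    (e.symm : Vec (Module.finrank ℝ W) →L[ℝ] W).le_opNorm _
  rw [e.symm_apply_apply] at h3
  refine h3.trans ?_
  rw [mul_assoc]
  refine mul_le_mul_of_nonneg_left (hres.trans ?_) (norm_nonneg _)
  exact mul_le_mul_of_nonneg_right (le_abs_self K) (pow_nonneg hh.1.le _)

/-- The order condition for the equation `y' = 1`. -/
theorem HasOrder.exists_abs_mul_sum_sub_le (hO : HasOrder A b p) :
    ∃ K : ℝ, 0 ≤ K ∧ ∀ᶠ h in 𝓝[>] (0 : ℝ), |h * ∑ i, b i - h| ≤ K * h ^ (p + 1) := by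
  obtain ⟨K, r, hK, hr, H⟩ := hO.exists_eventually_norm_sub_le (f := fun _ : ℝ => (1 : ℝ))
    contDiff_const one_pos (y := id) (fun t _ => hasDerivWithinAt_id t _)
  refine ⟨K, hK, ?_⟩
  have hnear : ∀ᶠ h in 𝓝[>] (0 : ℝ), ∀ i, h * |nodes A i| ≤ r :=
    eventually_all.2 fun i => eventually_mul_le _ hr
  filter_upwards [H, hnear, self_mem_nhdsWithin] with h h1 h2 h3
  have h4 := h1 (fun i => h * nodes A i) (fun i => by simp [nodes]) (fun i => by
    rw [id, sub_zero, norm_mul, Real.norm_eq_abs, Real.norm_eq_abs, abs_of_pos h3]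
    exact h2 i)
  simpa using h4

end Order

/-! ### The iteration started from exact stage values -/

section ExactStart

variable {s : ℕ} {E : Type*} [NormedAddCommGroup E] [NormedSpace ℝ E]
  {A : Matrix (Fin s) (Fin s) ℝ} {b : Fin s → ℝ} {p : ℕ} {G : E → E →L[ℝ] E} {L : NNReal}
  {τ T : ℝ} {y : ℝ → E}

theorem sum_abs_row_le (A : Matrix (Fin s) (Fin s) ℝ) (i : Fin s) :
    ∑ j, |A i j| ≤ ∑ i, ∑ j, |A i j| :=
  Finset.single_le_sum (f := fun i => ∑ j, |A i j|)
    (fun _ _ => Finset.sum_nonneg fun _ _ => abs_nonneg _) (Finset.mem_univ i)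

/-- All stages are within `O(h)` of the initial value, uniformly in the number of sweeps. In
particular they lie in the ball to which the order condition is restricted. -/
theorem exists_norm_iteration_sub_initial_le (hG : LipschitzWith L G) (hτ : τ ≤ 0) (hT : 0 < T)
    (hc : ∀ i, nodes A i < 0 → τ < 0) (hy : IsIntegralCurveOn y (fun _ u => G u u) (Ico τ T)) :
    ∃ M : ℝ, 0 ≤ M ∧ ∀ᶠ h in 𝓝[>] (0 : ℝ), ∀ (k : ℕ) (Z : ℕ → Fin s → E),
      (∀ i, Z 0 i = y (nodes A i * h)) → IsIteration A G h (y 0) k Z →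
        ∀ m ≤ k, ∀ i, ‖Z m i - y 0‖ ≤ M * h := by
  obtain ⟨M, hM, hMb⟩ := exists_norm_solution_nodes_sub_le hτ hT hc hy
  set R : ℝ := 2 * ‖y 0‖ + 1 with hR
  set a : ℝ := ∑ i, ∑ j, |A i j| with ha
  have ha0 : 0 ≤ a := Finset.sum_nonneg fun _ _ => Finset.sum_nonneg fun _ _ => abs_nonneg _
  set B : ℝ := ‖G 0‖ + L * R with hB
  refine ⟨M + a * (B * R), by positivity, ?_⟩
  filter_upwards [hMb, eventually_mul_le M one_pos, eventually_mul_le (a * B) one_half_pos,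
    self_mem_nhdsWithin] with h h1 h2 h3 h4 k Z hZ0 hZ
  have hh : 0 ≤ h := le_of_lt h4
  have hZ0R : ∀ i, ‖Z 0 i‖ ≤ R := fun i => by
    have := norm_le_norm_add_norm_sub' (Z 0 i) (y 0)
    have := h1 i
    rw [← hZ0 i] at this
    linarith [norm_nonneg (y 0)]
  have hb := norm_iteration_le hG (sum_abs_row_le A) hh (by rw [hR]; linarith) h3 hZ hZ0R
  intro m hm i
  cases m with
  | zero =>
    rw [hZ0 i]
    refine (h1 i).trans (mul_le_mul_of_nonneg_right ?_ hh)
    linarith [show 0 ≤ a * (B * R) by positivity]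
  | succ m =>
    rw [hZ m hm i, add_sub_cancel_left]
    refine (norm_smul_sum_smul_le hh (by positivity : 0 ≤ B * R) (sum_abs_row_le A i) fun j =>
      ((G (Z m j)).le_opNorm _).trans (mul_le_mul (norm_coeff_le hG (hb m (by omega) j))
        (hb _ hm j) (norm_nonneg _) (by positivity))).trans ?_
    rw [mul_comm]
    exact mul_le_mul_of_nonneg_right (by linarith) hh

/-- For order at most one only `∑ b_i = 1` (up to the appropriate power of `h`) matters, and
Lipschitz continuity of the coefficient suffices. -/
theorem exists_exact_start_error_le_of_le_one (hp : p ≤ 1) (hO : HasOrder A b p)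
    (hG : LipschitzWith L G) (hτ : τ ≤ 0) (hT : 0 < T) (hc : ∀ i, nodes A i < 0 → τ < 0)
    (hy : IsIntegralCurveOn y (fun _ u => G u u) (Ico τ T)) (k : ℕ) :
    ∃ K : ℝ, 0 ≤ K ∧ ∀ᶠ h in 𝓝[>] (0 : ℝ), ∀ Z : ℕ → Fin s → E,
      (∀ i, Z 0 i = y (nodes A i * h)) → IsIteration A G h (y 0) k Z →
        ‖iterationOutput b G h (y 0) k Z - y h‖ ≤ K * h ^ (p + 1) := by
  obtain ⟨M, hM, hMb⟩ := exists_norm_iteration_sub_initial_le hG hτ hT hc hy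
  obtain ⟨N, hN, hNb⟩ := exists_norm_solution_sub_taylor_le hG hτ hT hy
  obtain ⟨K, hK, hKb⟩ := hO.exists_abs_mul_sum_sub_le
  set B : ℝ := ‖G 0‖ + L * (‖y 0‖ + 1) with hB
  set D : ℝ := (∑ j, |b j|) * (B * M + L * M * ‖y 0‖) with hD
  have hD0 : 0 ≤ D := by positivity
  refine ⟨D + K * ‖G (y 0) (y 0)‖ + N, by positivity, ?_⟩
  filter_upwards [hMb, hNb, hKb, eventually_mul_le M one_pos, eventually_mul_le 1 one_pos,
    self_mem_nhdsWithin] with h h1 h2 h3 h4 h5 h6 Z hZ0 hZ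
  have hh : 0 ≤ h := le_of_lt h6
  rw [mul_one] at h5
  have hsq : h ^ 2 ≤ h ^ (p + 1) := pow_le_pow_of_le_one hh h5 (by omega)
  have hZb := h1 k Z hZ0 hZ
  have hterm : ∀ j, ‖G (Z (k - 1) j) (Z k j) - G (y 0) (y 0)‖ ≤
      (B * M + L * M * ‖y 0‖) * h := fun j => by
    have hU := hZb (k - 1) (by omega) j
    have hU' : ‖Z (k - 1) j‖ ≤ ‖y 0‖ + 1 := by
      have := norm_le_norm_add_norm_sub' (Z (k - 1) j) (y 0)
      linarith
    refine (norm_coeff_apply_sub_le hG _ _ _ _).trans ?_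
    have e1 : ‖G (Z (k - 1) j)‖ * ‖Z k j - y 0‖ ≤ B * (M * h) :=
      mul_le_mul (norm_coeff_le hG hU') (hZb k le_rfl j) (norm_nonneg _) (by positivity)
    have e2 : L * ‖Z (k - 1) j - y 0‖ * ‖y 0‖ ≤ L * (M * h) * ‖y 0‖ :=
      mul_le_mul_of_nonneg_right (mul_le_mul_of_nonneg_left hU L.2) (norm_nonneg _)
    refine (add_le_add e1 e2).trans_eq ?_
    ring
  have hsplit : iterationOutput b G h (y 0) k Z - y h =
      h • ∑ j, b j • (G (Z (k - 1) j) (Z k j) - G (y 0) (y 0)) +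
        (h * ∑ j, b j - h) • G (y 0) (y 0) - (y h - y 0 - h • G (y 0) (y 0)) := by
    simp only [iterationOutput, smul_sub, Finset.sum_sub_distrib, ← Finset.sum_smul, sub_smul,
      mul_smul]
    abel
  rw [hsplit]
  refine (norm_sub_le _ _).trans ?_
  refine (add_le_add (norm_add_le _ _) h2).trans ?_
  have e1 := norm_smul_sum_smul_le (c := b) hh (by positivity) le_rfl hterm
  have e1' : h * ((∑ j, |b j|) * ((B * M + L * M * ‖y 0‖) * h)) = D * h ^ 2 := by
    rw [hD]
    ring
  rw [e1'] at e1
  have e2 : ‖(h * ∑ j, b j - h) • G (y 0) (y 0)‖ ≤ K * h ^ (p + 1) * ‖G (y 0) (y 0)‖ := by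
    rw [norm_smul, Real.norm_eq_abs]
    exact mul_le_mul_of_nonneg_right h3 (norm_nonneg _)
  have e3 : D * h ^ 2 ≤ D * h ^ (p + 1) := mul_le_mul_of_nonneg_left hsq hD0
  have e4 : N * h ^ 2 ≤ N * h ^ (p + 1) := mul_le_mul_of_nonneg_left hsq hN
  calc _ ≤ D * h ^ (p + 1) + K * h ^ (p + 1) * ‖G (y 0) (y 0)‖ + N * h ^ (p + 1) := by linarith
    _ = _ := by ring

/-- The coefficient argument of the `m`-th equation of the cascade: the given path `ψ` for the
first equation, the preceding unknown for the others. -/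
def cascadeArg (ψ : ℝ → E) {k : ℕ} (x : ℝ × (Fin k → E)) (m : Fin k) : E :=
  if (m : ℕ) = 0 then ψ x.1 else x.2 ⟨m - 1, by omega⟩

/-- The autonomous vector field of the cascade `t' = 1`, `z₁' = G (ψ t) z₁`,
`z_{m+1}' = G (z_m) z_{m+1}`; the unknowns are indexed from `0`. -/
def cascade (G : E → E →L[ℝ] E) (ψ : ℝ → E) (k : ℕ) (x : ℝ × (Fin k → E)) : ℝ × (Fin k → E) :=
  (1, fun m => G (cascadeArg ψ x m) (x.2 m))

theorem contDiff_cascade (hG : ContDiff ℝ p G) {ψ : ℝ → E} (hψ : ContDiff ℝ p ψ) (k : ℕ) :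
    ContDiff ℝ p (cascade G ψ k) := by
  refine contDiff_const.prodMk (contDiff_pi.2 fun m => ?_)
  have hpr : ∀ j : Fin k, ContDiff ℝ p fun x : ℝ × (Fin k → E) => x.2 j := fun j =>
    (contDiff_apply ℝ E j).comp contDiff_snd
  refine ContDiff.clm_apply (hG.comp ?_) (hpr m)
  unfold cascadeArg
  split_ifs
  · exact hψ.comp contDiff_fst
  · exact hpr _

/-- The iteration with exact starting values is the Runge--Kutta method applied to the cascade
driven by the exact solution; every component of the cascade is solved by the exact solution. -/
theorem exists_exact_start_error_le_of_two_le [FiniteDimensional ℝ E] (hp : 2 ≤ p)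
    (hO : HasOrder A b p) (hG : LipschitzWith L G) (hGs : ContDiff ℝ p G) (hτ : τ ≤ 0) (hT : 0 < T)
    (hc : ∀ i, nodes A i < 0 → τ < 0) (hy : IsIntegralCurveOn y (fun _ u => G u u) (Ico τ T))
    {k : ℕ} (hk : 1 ≤ k) :
    ∃ K : ℝ, 0 ≤ K ∧ ∀ᶠ h in 𝓝[>] (0 : ℝ), ∀ Z : ℕ → Fin s → E,
      (∀ i, Z 0 i = y (nodes A i * h)) → IsIteration A G h (y 0) k Z →
        ‖iterationOutput b G h (y 0) k Z - y h‖ ≤ K * h ^ (p + 1) := by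
  have hF : ContDiff ℝ p fun u => G u u := hGs.clm_apply contDiff_id
  obtain ⟨ε, z, hε, hz, hzy⟩ := exists_two_sided_extension
    (hF.of_le (by exact_mod_cast (by omega : 1 ≤ p))) hτ hT hy
  obtain ⟨δ, ψ, hδ, hψ, hψz⟩ :=
    exists_contDiff_eq_near_zero hε (contDiffOn_of_hasDerivAt hF isOpen_Ioo hz)
  have hψy : ∀ t ∈ Ico τ T, |t| ≤ δ → ψ t = y t := fun t ht htδ => (hψz t htδ).trans (hzy t ht)
  obtain ⟨M, hM, hMb⟩ := exists_norm_iteration_sub_initial_le hG hτ hT hc hy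
  have hsol : IsIntegralCurveOn (fun t => ((t, fun _ => y t) : ℝ × (Fin k → E)))
      (fun _ => cascade G ψ k) (Ico 0 (min δ T)) := fun t ht => by
    have htT : t ∈ Ico τ T := ⟨hτ.trans ht.1, ht.2.trans_le (min_le_right _ _)⟩
    have htδ : |t| ≤ δ := by
      rw [abs_of_nonneg ht.1]
      exact (ht.2.trans_le (min_le_left _ _)).le
    have hsub : Ico 0 (min δ T) ⊆ Ico τ T := Ico_subset_Ico hτ (min_le_right _ _)
    refine (hasDerivWithinAt_id t _).prodMk (hasDerivWithinAt_pi.2 fun m => ?_)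
    have harg : cascadeArg ψ ((t, fun _ => y t) : ℝ × (Fin k → E)) m = y t := by
      unfold cascadeArg
      split_ifs
      · exact hψy t htT htδ
      · rfl
    rw [harg]
    exact (hy t htT).mono hsub
  obtain ⟨K, r, hK, hr, H⟩ := hO.exists_eventually_norm_sub_le (contDiff_cascade hGs hψ k)
    (lt_min hδ hT) hsol
  have hnode : ∀ {r : ℝ}, 0 < r → ∀ᶠ h in 𝓝[>] (0 : ℝ), ∀ i, h * |nodes A i| ≤ r := fun hr =>
    eventually_all.2 fun i => eventually_mul_le _ hr
  have hmem : ∀ᶠ h in 𝓝[>] (0 : ℝ), ∀ i, nodes A i * h ∈ Ico τ T := eventually_all.2 fun i =>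
    (tendsto_nhdsWithin_iff.1 (tendsto_nodes_mul hτ hT hc i)).2
  refine ⟨K, hK, ?_⟩
  filter_upwards [H, hMb, hnode hr, hnode hδ, hmem, eventually_mul_le M hr, self_mem_nhdsWithin]
    with h h1 h2 h3 h4 h5 h6 h7 Z hZ0 hZ
  have hh : 0 < h := h7
  have habs : ∀ i, |nodes A i * h| = h * |nodes A i| := fun i => by
    rw [abs_mul, abs_of_pos hh, mul_comm]
  -- The stages of the Runge--Kutta method for the cascade.
  let X : Fin s → ℝ × (Fin k → E) := fun i => (nodes A i * h, fun m => Z (m + 1) i)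
  have harg : ∀ i m, cascadeArg ψ (X i) m = Z m i := fun i m => by
    unfold cascadeArg
    split_ifs with hm
    · rw [hm, hZ0 i]
      exact hψy _ (h5 i) (by rw [habs]; exact h4 i)
    · change Z ((m : ℕ) - 1 + 1) i = Z m i
      rw [Nat.sub_add_cancel (Nat.pos_of_ne_zero hm)]
  have hstage : ∀ i, X i = ((0 : ℝ), fun _ => y 0) + h • ∑ j, A i j • cascade G ψ k (X j) := by
    intro i
    refine Prod.ext ?_ (funext fun m => ?_)
    · simp [X, cascade, Prod.fst_sum, nodes, mul_comm]
    · simp only [cascade, Prod.snd_add, Prod.smul_snd, Prod.snd_sum, Pi.add_apply, Pi.smul_apply,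
        Finset.sum_apply, harg]
      exact hZ m m.2 i
  have hnear : ∀ i, ‖X i - ((0 : ℝ), fun _ => y 0)‖ ≤ r := fun i => by
    refine norm_prod_le_iff.2 ⟨?_, (pi_norm_le_iff_of_nonneg hr.le).2 fun m => ?_⟩
    · simp only [X, Prod.fst_sub, sub_zero, Real.norm_eq_abs, habs]
      exact h3 i
    · refine (h2 k Z hZ0 hZ (m + 1) m.2 i).trans ?_
      rw [mul_comm]
      exact h6
  have hres := h1 X hstage hnear
  -- The output of the iteration is the last component of the output for the cascade.
  refine le_trans ?_ hres
  refine le_trans (le_of_eq ?_) ((norm_le_pi_norm _ (⟨k - 1, by omega⟩ : Fin k)).trans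
    (norm_snd_le _))
  congr 1
  simp only [iterationOutput, cascade, Prod.snd_add, Prod.snd_sub, Prod.smul_snd, Prod.snd_sum,
    Pi.add_apply, Pi.sub_apply, Pi.smul_apply, Finset.sum_apply, harg, X, Nat.sub_add_cancel hk]

end ExactStart

/-! ### Accuracy of the iteration -/

section Accuracy

variable {s : ℕ} {E : Type*} [NormedAddCommGroup E] [NormedSpace ℝ E] [FiniteDimensional ℝ E]
  {A : Matrix (Fin s) (Fin s) ℝ} {b : Fin s → ℝ} {p : ℕ} {G : E → E →L[ℝ] E} {L : NNReal}
  {τ T : ℝ} {y : ℝ → E}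

/-- The accuracy estimate for `u ↦ G u u`, obtained by comparing with the iteration started from the
exact values `y(c_i h)`. -/
theorem exists_eventually_iteration_accuracy (hO : HasOrder A b p) (hG : LipschitzWith L G)
    (hGs : 2 ≤ p → ContDiff ℝ p G) (hτ : τ ≤ 0) (hT : 0 < T) (hc : ∀ i, nodes A i < 0 → τ < 0)
    (hy : IsIntegralCurveOn y (fun _ u => G u u) (Ico τ T)) {k : ℕ} (hk : 1 ≤ k) (C : ℝ) :
    ∃ C' : ℝ, ∀ᶠ h in 𝓝[>] (0 : ℝ), ∀ (q : ℕ) (Y₀ : Fin s → E),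
      (∀ i, ‖Y₀ i - y (nodes A i * h)‖ ≤ C * h ^ q) →
        (∃ Y : ℕ → Fin s → E, Y 0 = Y₀ ∧ IsIteration A G h (y 0) k Y) ∧
        ∀ Y : ℕ → Fin s → E, Y 0 = Y₀ → IsIteration A G h (y 0) k Y →
          ‖iterationOutput b G h (y 0) k Y - y h‖ ≤ C' * h ^ (min p (q + k - 1) + 1) := by
  obtain ⟨K, hK, hKb⟩ : ∃ K : ℝ, 0 ≤ K ∧ ∀ᶠ h in 𝓝[>] (0 : ℝ), ∀ Z : ℕ → Fin s → E,
      (∀ i, Z 0 i = y (nodes A i * h)) → IsIteration A G h (y 0) k Z →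
        ‖iterationOutput b G h (y 0) k Z - y h‖ ≤ K * h ^ (p + 1) := by
    rcases le_or_gt 2 p with hp | hp
    · exact exists_exact_start_error_le_of_two_le hp hO hG (hGs hp) hτ hT hc hy hk
    · exact exists_exact_start_error_le_of_le_one (by omega) hO hG hτ hT hc hy k
  obtain ⟨M, hM, hMb⟩ := exists_norm_solution_nodes_sub_le hτ hT hc hy
  -- `R` bounds the perturbed starting values for every `q` at once, since `h ^ q ≤ 1`.
  set R : ℝ := 2 * ‖y 0‖ + 1 + |C| with hR
  have hR0 : 0 ≤ R := by positivity
  set a : ℝ := ∑ i, ∑ j, |A i j| with ha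
  have ha0 : 0 ≤ a := Finset.sum_nonneg fun _ _ => Finset.sum_nonneg fun _ _ => abs_nonneg _
  have hRy : 2 * ‖y 0‖ ≤ R := by linarith [abs_nonneg C]
  set P : ℝ := (∑ j, |b j|) * ((‖G 0‖ + L * R) * (2 * (a * (L * R))) ^ k +
        L * R * (2 * (a * (L * R))) ^ (k - 1)) with hP
  have hP0 : 0 ≤ P := by positivity
  refine ⟨P * |C| + K, ?_⟩
  filter_upwards [hKb, hMb, eventually_mul_le M one_pos, eventually_mul_le 1 one_pos,
    eventually_mul_le (a * (‖G 0‖ + L * R)) one_half_pos, self_mem_nhdsWithin]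
    with h h1 h2 h3 h4 h5 h6 q Y₀ hY₀
  have hh : 0 ≤ h := le_of_lt h6
  rw [mul_one] at h4
  have hz0 : ∀ i, ‖y (nodes A i * h)‖ ≤ ‖y 0‖ + 1 := fun i => by
    have := norm_le_norm_add_norm_sub' (y (nodes A i * h)) (y 0)
    have := h2 i
    linarith
  have hd : ∀ i, ‖Y₀ i - y (nodes A i * h)‖ ≤ |C| * h ^ q := fun i =>
    (hY₀ i).trans (mul_le_mul_of_nonneg_right (le_abs_self C) (pow_nonneg hh q))
  have hq1 : |C| * h ^ q ≤ |C| := mul_le_of_le_one_right (abs_nonneg C) (pow_le_one₀ hh h4)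
  have hY₀R : ∀ i, ‖Y₀ i‖ ≤ R := fun i => by
    have := norm_le_norm_add_norm_sub' (Y₀ i) (y (nodes A i * h))
    linarith [hz0 i, hd i, norm_nonneg (y 0)]
  refine ⟨exists_isIteration hG (sum_abs_row_le A) hh hRy h5 Y₀ hY₀R k, fun Y hY0 hY => ?_⟩
  have hzR : ∀ i, ‖y (nodes A i * h)‖ ≤ R := fun i => by
    linarith [hz0 i, norm_nonneg (y 0), abs_nonneg C]
  obtain ⟨Z, hZ0, hZ⟩ := exists_isIteration hG (sum_abs_row_le A) hh hRy h5
    (fun i => y (nodes A i * h)) hzR k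
  have e1 := h1 Z (fun i => congrFun hZ0 i) hZ
  have e2 := norm_iterationOutput_sub_le b hG (sum_abs_row_le A) ha0 hh h4 hRy h5
    (by positivity : 0 ≤ |C| * h ^ q) hk hY hZ (by simpa [hY0] using hY₀R)
    (by simpa [hZ0] using hzR) (by simpa [hY0, hZ0] using hd)
  rw [← hP] at e2
  have e3 : P * h ^ k * (|C| * h ^ q) ≤ P * |C| * h ^ (min p (q + k - 1) + 1) := by
    have : P * h ^ k * (|C| * h ^ q) = P * |C| * h ^ (q + k) := by ring
    rw [this]
    exact mul_le_mul_of_nonneg_left (pow_le_pow_of_le_one hh h4 (by omega)) (by positivity)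
  have e4 : K * h ^ (p + 1) ≤ K * h ^ (min p (q + k - 1) + 1) :=
    mul_le_mul_of_nonneg_left (pow_le_pow_of_le_one hh h4 (by omega)) hK
  calc ‖iterationOutput b G h (y 0) k Y - y h‖
      ≤ ‖iterationOutput b G h (y 0) k Y - iterationOutput b G h (y 0) k Z‖ +
        ‖iterationOutput b G h (y 0) k Z - y h‖ := norm_sub_le_norm_sub_add_norm_sub _ _ _
    _ ≤ P * |C| * h ^ (min p (q + k - 1) + 1) + K * h ^ (min p (q + k - 1) + 1) := by linarith
    _ = _ := by ring

end Accuracy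

/-- Right multiplication by `Q`, as a map from matrices to operators on Euclidean space: it sends
`S u` to the operator `v ↦ S u (Q v)`. -/
def matrixToOperator {d : ℕ} (Q : Matrix (Fin d) (Fin d) ℝ) :
    Matrix (Fin d) (Fin d) ℝ →L[ℝ] (Vec d →L[ℝ] Vec d) :=
  LinearMap.toContinuousLinearMap
    { toFun := fun M => (Matrix.toEuclideanCLM (n := Fin d) (𝕜 := ℝ) M).comp
        (Matrix.toEuclideanCLM (n := Fin d) (𝕜 := ℝ) Q)
      map_add' := fun M N => by
        rw [map_add, ContinuousLinearMap.add_comp]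
      map_smul' := fun r M => by
        rw [map_smul, ContinuousLinearMap.smul_comp, RingHom.id_apply] }

theorem field_eq_matrixToOperator {d : ℕ} {Q : Matrix (Fin d) (Fin d) ℝ} (hQ : Q.IsSymm)
    (S : Vec d → Matrix (Fin d) (Fin d) ℝ) (u v : Vec d) :
    field S Q u v = matrixToOperator Q (S u) v := by
  rw [field, gradient_quadV hQ]
  rfl

end SemiImplicitRK

end

/-- Accuracy of the semi-implicit iteration. -/
theorem mainTheorem1 {d s : ℕ}
    (S : SemiImplicitRK.Vec d → Matrix (Fin d) (Fin d) ℝ)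
    (Q : Matrix (Fin d) (Fin d) ℝ) (hQ : Q.IsSymm)
    (A : Matrix (Fin s) (Fin s) ℝ) (b : Fin s → ℝ) (p : ℕ)
    (hLip : ∃ L : NNReal, LipschitzWith L S)
    (hSmooth : 2 ≤ p → ContDiff ℝ p S)
    (hOrder : SemiImplicitRK.HasOrder A b p)
    (τ T : ℝ) (hτ : τ ≤ 0) (hT : 0 < T)
    (hc : ∀ i, SemiImplicitRK.nodes A i < 0 → τ < 0)
    (y : ℝ → SemiImplicitRK.Vec d)
    (hy : IsIntegralCurveOn y (fun _ u => SemiImplicitRK.field S Q u u) (Set.Ico τ T))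
    (k : ℕ) (hk : 1 ≤ k) (C : ℝ) :
    ∃ C' h₀ : ℝ, 0 < h₀ ∧ ∀ (q : ℕ) (h : ℝ), 0 < h → h ≤ h₀ →
      ∀ Y₀ : Fin s → SemiImplicitRK.Vec d,
        (∀ i, ‖Y₀ i - y (SemiImplicitRK.nodes A i * h)‖ ≤ C * h ^ q) →
        (∃ Y : ℕ → Fin s → SemiImplicitRK.Vec d,
          Y 0 = Y₀ ∧ SemiImplicitRK.IsSemiImplicitIteration S Q A h (y 0) k Y) ∧
        ∀ Y : ℕ → Fin s → SemiImplicitRK.Vec d,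
          Y 0 = Y₀ → SemiImplicitRK.IsSemiImplicitIteration S Q A h (y 0) k Y →
          ‖SemiImplicitRK.semiImplicitOutput S Q b h (y 0) k Y - y h‖
            ≤ C' * h ^ (min p (q + k - 1) + 1) := by
  obtain ⟨L, hL⟩ := hLip
  simp only [SemiImplicitRK.IsSemiImplicitIteration, SemiImplicitRK.semiImplicitOutput,
    SemiImplicitRK.field_eq_matrixToOperator hQ] at hy ⊢
  obtain ⟨C', hC'⟩ := SemiImplicitRK.exists_eventually_iteration_accuracy hOrder
    ((SemiImplicitRK.matrixToOperator Q).lipschitz.comp hL)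
    (fun hp => (SemiImplicitRK.matrixToOperator Q).contDiff.comp (hSmooth hp)) hτ hT hc hy hk C
  obtain ⟨h₀, hh₀, hsub⟩ := mem_nhdsGT_iff_exists_Ioc_subset.1 hC'
  exact ⟨C', h₀, hh₀, fun q h hpos hle => hsub ⟨hpos, hle⟩ q⟩
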